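/- Let $G=(V,E)$ be a finite directed acyclic graph with three senders $s_1,s_2,s_3$ and three receivers $d_1,d_2,d_3$. Each sender $s_i$ has no incoming edge and exactly one outgoing edge $\sigma_i$; each receiver $d_i$ has no outgoing edge and exactly one incoming edge $\tau_i$. A directed path from an edge $e$ to an edge $e'$ is a sequence of distinct edges $P=(e_1,\dots,e_k)$, $k\ge 1$, with $e_1=e$, $e_k=e'$, in which each $e_{l+1}$ starts at the node where $e_l$ ends. Assume that for all $i,j\in\{1,2,3\}$ there is a directed path from $\sigma_i$ to $\tau_j$. Let $\mathbf{x}=(x_{e'e})$ be a family of independent variables, one for each pair of edges such that $e$ starts at the node where $e'$ ends, and define the transfer functions $$m_{ij}=\sum_{P=(e_1,\dots,e_k)}\ \prod_{l=1}^{k-1}x_{e_le_{l+1}}\in\mathbb{F}_2[\mathbf{x}],$$ where the sum is over all directed paths $P$ from $\sigma_i$ to $\tau_j$. In the field $\mathbb{F}_2(\mathbf{x})$ put $$p_1=\frac{m_{13}m_{21}}{m_{11}m_{23}},\quad p_2=\frac{m_{13}m_{22}}{m_{12}m_{23}},\quad p_3=\frac{m_{21}m_{33}}{m_{23}m_{31}},\quad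 \eta=\frac{m_{13}m_{21}m_{32}}{m_{12}m_{23}m_{31}}.$$ For sets of edges $C,S,D$, say that $C$ is a cut-set between $S$ and $D$ if every directed path from an edge of $S$ to an edge of $D$ contains an edge of $C$; an edge $e$ is a bottleneck between $S$ and $D$ if $\{e\}$ is a cut-set between them. Fix any topological ordering of $E$, that is, a linear order in which $e$ precedes $e'$ whenever $e'$ starts at the node where $e$ ends, and let $\alpha_{ijk}$ be the last bottleneck between $\{\sigma_i\}$ and $\{\tau_j,\tau_k\}$ in this order. Two edges are parallel if there is no directed path from either one to the other (in particular, since $(e)$ is a directed path from $e$ to $e$, parallel edges are distinct). Then: 1. $1+\eta\neq 0$ and $p_1=\frac{\eta}{1+\eta}$ if and only if: (a) $\alpha_{312}$ is a bottleneck between $\sigma_1$ and $\tau_2$; (b) $\alpha_{213}$ is a bottleneck between $\sigma_1$ and $\tau_3$; (c) $\alpha_{312}$ and $\alpha_{213}$ are parallel; and (d) $\{\alpha_{312},\alpha_{213}\}$ is a cut-set between $\sigma_1$ and $\tau_1$. 2. $p_2=1+\eta$ if and only if: (a) $\alpha_{123}$ is a bottleneck between $\sigma_2$ and $\tau_3$;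 (b) $\alpha_{321}$ is a bottleneck between $\sigma_2$ and $\tau_1$; (c) $\alpha_{123}$ and $\alpha_{321}$ are parallel; and (d) $\{\alpha_{123},\alpha_{321}\}$ is a cut-set between $\sigma_2$ and $\tau_2$. 3. $p_3=1+\eta$ if and only if: (a) $\alpha_{231}$ is a bottleneck between $\sigma_3$ and $\tau_1$; (b) $\alpha_{132}$ is a bottleneck between $\sigma_3$ and $\tau_2$; (c) $\alpha_{231}$ and $\alpha_{132}$ are parallel; and (d) $\{\alpha_{231},\alpha_{132}\}$ is a cut-set between $\sigma_3$ and $\tau_3$. -/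

import Mathlib

/-- A single-input single-output communication scenario with three unicast sessions: a directed
acyclic (multi)graph with node set `V` and edge set `E`, an edge `e` going from the node `tail e` to
the node `head e`, together with three senders `s i` and three receivers `d i`. Each sender `s i` is
connected to the network by a single edge `σ i` and has no incoming edge; each receiver `d i` is
connected by a single edge `τ i` and has no outgoing edge.

The sessions are indexed by `Fin 3`. Numerals in `Fin 3` are read modulo 3, so `1, 2, 3 : Fin 3` are
the three distinct elements, standing for sessions 1, 2 and 3. -/
structure SISO (V E : Type*) where
  tail : E → V
  head : E → V
  acyclic : ∀ e : E, ¬ Relation.TransGen (fun a b : E => head a = tail b) e e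
  s : Fin 3 → V
  d : Fin 3 → V
  σ : Fin 3 → E
  τ : Fin 3 → E
  tail_eq_s_iff : ∀ i e, tail e = s i ↔ e = σ i
  head_ne_s : ∀ i e, head e ≠ s i
  head_eq_d_iff : ∀ i e, head e = d i ↔ e = τ i
  tail_ne_d : ∀ i e, tail e ≠ d i

namespace SISO

variable {V E : Type*}

/-- `P = [e₁, …, eₖ]` is a directed path from the edge `e` to the edge `e'`: its edges are pairwise
distinct, `e₁ = e`, `eₖ = e'` and `head eᵢ = tail eᵢ₊₁`. In particular `[e]` is the (trivial) directed
path from `e` to `e`. -/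
structure IsPath (N : SISO V E) (e e' : E) (P : List E) : Prop where
  nodup : P.Nodup
  chain : P.IsChain (fun a b => N.head a = N.tail b)
  first : P.head? = some e
  last : P.getLast? = some e'

/-- `C` is a cut-set between the edge sets `S` and `D`: removing the edges in `C` destroys every
directed path from an edge of `S` to an edge of `D`. -/
def IsCutSet (N : SISO V E) (C S D : Set E) : Prop :=
  ∀ a ∈ S, ∀ b ∈ D, ∀ P : List E, N.IsPath a b P → ∃ c ∈ C, c ∈ P

/-- The edge `e` is a bottleneck between the edge sets `S` and `D`. -/
def IsBottleneck (N : SISO V E) (e : E) (S D : Set E) : Prop :=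
  N.IsCutSet {e} S D

/-- Two edges are parallel if there is no directed path from either of them to the other one. (As
`[e]` is a path from `e` to `e`, parallel edges are distinct.) -/
def Parallel (N : SISO V E) (e e' : E) : Prop :=
  (¬ ∃ P, N.IsPath e e' P) ∧ (¬ ∃ P, N.IsPath e' e P)

/-- All senders are connected to all receivers via directed paths. -/
def FullyConnected (N : SISO V E) : Prop :=
  ∀ i j : Fin 3, ∃ P, N.IsPath (N.σ i) (N.τ j) P

/-- The linear order on the edges is a topological ordering. -/
def IsTopological [LinearOrder E] (N : SISO V E) : Prop :=
  ∀ e e' : E, N.head e = N.tail e' → e < e'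

theorem isBottleneck_source (N : SISO V E) (e : E) (D : Set E) : N.IsBottleneck e {e} D := by
  rintro a rfl b _ P hP
  exact ⟨a, rfl, List.mem_of_mem_head? (by simp [hP.first])⟩

open Classical in
/-- The set of all bottlenecks between `S` and `D`. -/
noncomputable def bottlenecks [Fintype E] (N : SISO V E) (S D : Set E) : Finset E :=
  Finset.univ.filter fun e => N.IsBottleneck e S D

theorem bottlenecks_source_nonempty [Fintype E] (N : SISO V E) (e : E) (D : Set E) :
    (N.bottlenecks {e} D).Nonempty :=
  ⟨e, by simp [bottlenecks, isBottleneck_source]⟩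

/-- `α i j k` is the last bottleneck, in the given ordering of the edges, between `σ i` and
`{τ j, τ k}`. -/
noncomputable def α [Fintype E] [LinearOrder E] (N : SISO V E) (i j k : Fin 3) : E :=
  (N.bottlenecks {N.σ i} {N.τ j, N.τ k}).max' (N.bottlenecks_source_nonempty _ _)

/-- The gain `t_P = x_{e₁e₂} x_{e₂e₃} ⋯ x_{eₖ₋₁eₖ}` along `P = [e₁, …, eₖ]`, where `X (e', e)` is the
coding coefficient `x_{e'e}`. Only the variables `X (e', e)` with `head e' = tail e` occur along a
directed path. -/
noncomputable def gain (P : List E) : MvPolynomial (E × E) (ZMod 2) :=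
  ((P.zip P.tail).map MvPolynomial.X).prod

open Classical in
/-- The transfer function `m_{ij}`, the sum of the gains along all directed paths from `σ i` to
`τ j`, with coefficients in the field with two elements. -/
noncomputable def transfer [Fintype E] (N : SISO V E) (i j : Fin 3) :
    MvPolynomial (E × E) (ZMod 2) :=
  ∑ P : {P : List E // P.Nodup} with N.IsPath (N.σ i) (N.τ j) P.1, gain P.1

/-- The transfer function `m_{ij}` as an element of the field of rational functions in the coding
coefficients. -/
noncomputable def m [Fintype E] (N : SISO V E) (i j : Fin 3) :
    FractionRing (MvPolynomial (E × E) (ZMod 2)) :=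
  algebraMap _ _ (N.transfer i j)

noncomputable def p₁ [Fintype E] (N : SISO V E) : FractionRing (MvPolynomial (E × E) (ZMod 2)) :=
  (N.m 1 3 * N.m 2 1) / (N.m 1 1 * N.m 2 3)

noncomputable def p₂ [Fintype E] (N : SISO V E) : FractionRing (MvPolynomial (E × E) (ZMod 2)) :=
  (N.m 1 3 * N.m 2 2) / (N.m 1 2 * N.m 2 3)

noncomputable def p₃ [Fintype E] (N : SISO V E) : FractionRing (MvPolynomial (E × E) (ZMod 2)) :=
  (N.m 2 1 * N.m 3 3) / (N.m 2 3 * N.m 3 1)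

noncomputable def η [Fintype E] (N : SISO V E) : FractionRing (MvPolynomial (E × E) (ZMod 2)) :=
  (N.m 1 3 * N.m 2 1 * N.m 3 2) / (N.m 1 2 * N.m 2 3 * N.m 3 1)

end SISO

/-!
Write `M e t` (`edgeTransfer`) for the sum of the gains of the directed paths from the edge `e` to
the edge `t`. After clearing denominators each of the three equations becomes, for a cyclic
relabelling `i, j, k` of the sessions, the identity `m i i * m j k * m k j = m i j * m j k * m k i
+ m i k * m j i * m k j`, and the graph conditions are those for `a = α k i j` and `b = α j i k`
(`m_identity_iff`). Dividing by `m j k * m k j` and using that `M` factors at bottlenecks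
(`Separates.edgeTransfer_mul`), the identity says that `M s t₁` equals `M s t₂ * M a t₁ / M a t₂ +
M s t₃ * M b t₁ / M b t₃`, where `s = σ i` and `t₁, t₂, t₃` are the edges `τ i, τ j, τ k`. If the
graph conditions hold, the right side is `M s a * M a t₁ + M s b * M b t₁`, the sum over the paths
through `a` plus the sum over those through `b`, and these two classes partition the paths from
`s` to `t₁`.

For the converse the essential point is a dictionary between divisibility and bottlenecks.
Transfer functions are multilinear, so two factors of one involve disjoint sets of variables, and
the parts of two paths belonging to the two factors can be recombined to a path. Hence a path can
change from the variables of one factor to those of the other only at a bottleneck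
(`separates_of_vars_change`), and two transfer functions are coprime unless they have two
different bottlenecks in common (`isRelPrime_edgeTransfer`). Conversely, if `M x t` divides `M e
t` then `x` is a bottleneck between `e` and `t`.

As `a` and `b` are last bottlenecks, `M a t₁`, `M a t₂` are coprime, and so are `M b t₁`, `M b
t₃`. If `a → t₂` and `b → t₃` have no common bottleneck, `M a t₂` and `M b t₃` are coprime too;
the identity then gives `M a t₂ ∣ M s t₂` and `M b t₃ ∣ M s t₃`, which are the first two graph
conditions, and turns into `M s t₁ = M s a * M a t₁ + M s b * M b t₁`. In characteristic two a
path through both `a` and `b`, or through neither, contradicts this equation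
(`parallel_of_edgeTransfer_eq_add`), which yields the other two. A common bottleneck is
impossible: `not_separates_common` derives from its existence that one of `a`, `b` lies behind the
other, and the same equation, or the vanishing of a nonzero product.
-/

/-! ### Directed paths in a topological ordering -/

namespace SISO

variable {V E : Type*}

/-- There is a directed path from `e` to `t`. -/
def Reaches (N : SISO V E) (e t : E) : Prop := ∃ P, N.IsPath e t P

/-- Every directed path from `e` to `t` contains the edge `c`. -/
def Separates (N : SISO V E) (c e t : E) : Prop := ∀ P, N.IsPath e t P → c ∈ P

theorem isBottleneck_singleton_iff {N : SISO V E} {c e t : E} :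
    N.IsBottleneck c {e} {t} ↔ N.Separates c e t := by
  simp [IsBottleneck, IsCutSet, Separates]

theorem isBottleneck_pair_iff {N : SISO V E} {c e t t' : E} :
    N.IsBottleneck c {e} {t, t'} ↔ N.Separates c e t ∧ N.Separates c e t' := by
  simp [IsBottleneck, IsCutSet, Separates]

theorem IsPath.start_mem {N : SISO V E} {e t : E} {P : List E} (h : N.IsPath e t P) : e ∈ P :=
  List.mem_of_mem_head? (by simp [h.first])

theorem IsPath.end_mem {N : SISO V E} {e t : E} {P : List E} (h : N.IsPath e t P) : t ∈ P :=
  List.mem_of_getLast? h.last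

theorem separates_start (N : SISO V E) (e t : E) : N.Separates e e t := fun _ h => h.start_mem

theorem separates_end (N : SISO V E) (e t : E) : N.Separates t e t := fun _ h => h.end_mem

theorem isPath_singleton (N : SISO V E) (e : E) : N.IsPath e e [e] :=
  ⟨by simp, by simp, by simp, by simp⟩

theorem Reaches.refl (N : SISO V E) (e : E) : N.Reaches e e := ⟨_, N.isPath_singleton e⟩

theorem IsPath.eq_cons {N : SISO V E} {e t : E} {P : List E} (h : N.IsPath e t P) :
    ∃ L, P = e :: L := by
  have := h.first
  cases P with
  | nil => simp at this
  | cons a L => exact ⟨L, by simp_all⟩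

theorem IsPath.eq_concat {N : SISO V E} {e t : E} {P : List E} (h : N.IsPath e t P) :
    ∃ L, P = L ++ [t] := List.getLast?_eq_some_iff.mp h.last

section Topological

variable [LinearOrder E] {N : SISO V E} (hord : N.IsTopological)
include hord

theorem pairwise_lt_of_isChain {P : List E} (h : P.IsChain fun a b => N.head a = N.tail b) :
    P.Pairwise (· < ·) :=
  (h.imp fun _ _ h => hord _ _ h).pairwise

/-- Splitting and concatenation of directed paths at an edge `c`. Distinctness of the edges is
automatic, because they increase in the topological ordering. -/
theorem isPath_append_cons_iff {e t c : E} {L₁ L₂ : List E} :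
    N.IsPath e t (L₁ ++ c :: L₂) ↔ N.IsPath e c (L₁ ++ [c]) ∧ N.IsPath c t (c :: L₂) := by
  constructor
  · intro h
    have hc := List.isChain_split.mp h.chain
    refine ⟨⟨(pairwise_lt_of_isChain hord hc.1).imp ne_of_lt, hc.1, ?_, by simp⟩,
      ⟨(pairwise_lt_of_isChain hord hc.2).imp ne_of_lt, hc.2, by simp, ?_⟩⟩
    · have := h.first
      cases L₁ <;> simpa using this
    · have := h.last
      simpa using this
  · rintro ⟨h₁, h₂⟩
    have hc := List.isChain_split.mpr ⟨h₁.chain, h₂.chain⟩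
    refine ⟨(pairwise_lt_of_isChain hord hc).imp ne_of_lt, hc, ?_, ?_⟩
    · have := h₁.first
      cases L₁ <;> simpa using this
    · have := h₂.last
      simpa using this

theorem IsPath.split {e t c : E} {P : List E} (h : N.IsPath e t P) (hc : c ∈ P) :
    ∃ L₁ L₂, P = L₁ ++ c :: L₂ ∧ N.IsPath e c (L₁ ++ [c]) ∧ N.IsPath c t (c :: L₂) := by
  obtain ⟨L₁, L₂, rfl⟩ := List.append_of_mem hc
  exact ⟨L₁, L₂, rfl, (isPath_append_cons_iff hord).mp h⟩

theorem IsPath.trans {e t c : E} {P Q : List E} (hP : N.IsPath e c P) (hQ : N.IsPath c t Q) :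
    ∃ R, N.IsPath e t R ∧ ∀ x, x ∈ R ↔ x ∈ P ∨ x ∈ Q := by
  obtain ⟨L₁, rfl⟩ := hP.eq_concat
  obtain ⟨L₂, rfl⟩ := hQ.eq_cons
  refine ⟨L₁ ++ c :: L₂, (isPath_append_cons_iff hord).mpr ⟨hP, hQ⟩, fun x => ?_⟩
  simp only [List.mem_append, List.mem_cons, List.not_mem_nil]
  tauto

theorem Reaches.trans {e t c : E} (h₁ : N.Reaches e c) (h₂ : N.Reaches c t) : N.Reaches e t := by
  obtain ⟨P, hP⟩ := h₁
  obtain ⟨Q, hQ⟩ := h₂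
  obtain ⟨R, hR, -⟩ := hP.trans hord hQ
  exact ⟨R, hR⟩

theorem IsPath.start_le {e t c : E} {P : List E} (h : N.IsPath e t P) (hc : c ∈ P) : e ≤ c := by
  obtain ⟨L, rfl⟩ := h.eq_cons
  rcases List.mem_cons.mp hc with rfl | hc
  · exact le_rfl
  · exact (List.rel_of_pairwise_cons (pairwise_lt_of_isChain hord h.chain) hc).le

theorem IsPath.le_end {e t c : E} {P : List E} (h : N.IsPath e t P) (hc : c ∈ P) : c ≤ t := by
  obtain ⟨L, rfl⟩ := h.eq_concat
  rcases List.mem_append.mp hc with hc' | hc'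
  · exact ((List.pairwise_append.mp (pairwise_lt_of_isChain hord h.chain)).2.2 c hc' t (by simp)).le
  · simp_all

theorem IsPath.reaches_left {e t c : E} {P : List E} (h : N.IsPath e t P) (hc : c ∈ P) :
    N.Reaches e c := by
  obtain ⟨L₁, L₂, -, h₁, -⟩ := h.split hord hc
  exact ⟨_, h₁⟩

theorem IsPath.reaches_right {e t c : E} {P : List E} (h : N.IsPath e t P) (hc : c ∈ P) :
    N.Reaches c t := by
  obtain ⟨L₁, L₂, -, -, h₂⟩ := h.split hord hc
  exact ⟨_, h₂⟩

theorem IsPath.reaches_of_le {e t c d : E} {P : List E} (h : N.IsPath e t P) (hc : c ∈ P)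
    (hd : d ∈ P) (hcd : c ≤ d) : N.Reaches c d := by
  obtain ⟨L₁, L₂, rfl, h₁, h₂⟩ := h.split hord hc
  rcases List.mem_append.mp hd with hd | hd
  · obtain rfl := le_antisymm hcd (h₁.le_end hord (by simp [hd]))
    exact Reaches.refl N c
  · exact h₂.reaches_left hord hd

theorem Separates.reaches_left {e t c : E} (h : N.Separates c e t) (hr : N.Reaches e t) :
    N.Reaches e c := by
  obtain ⟨P, hP⟩ := hr
  exact hP.reaches_left hord (h P hP)

theorem Separates.reaches_right {e t c : E} (h : N.Separates c e t) (hr : N.Reaches e t) :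
    N.Reaches c t := by
  obtain ⟨P, hP⟩ := hr
  exact hP.reaches_right hord (h P hP)

theorem Separates.le_end {e t c : E} (h : N.Separates c e t) (hr : N.Reaches e t) : c ≤ t := by
  obtain ⟨P, hP⟩ := hr
  exact hP.le_end hord (h P hP)

theorem Separates.start_le {e t c : E} (h : N.Separates c e t) (hr : N.Reaches e t) : e ≤ c := by
  obtain ⟨P, hP⟩ := hr
  exact hP.start_le hord (h P hP)

theorem Separates.trans_right {e t c d : E} (hc : N.Separates c e t) (hd : N.Separates d c t) :
    N.Separates d e t := by
  intro P hP
  obtain ⟨L₁, L₂, rfl, -, h₂⟩ := hP.split hord (hc P hP)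
  exact List.mem_append_right _ (hd _ h₂)

theorem Separates.trans_left {e t c d : E} (hc : N.Separates c e t) (hd : N.Separates d e c) :
    N.Separates d e t := by
  intro P hP
  obtain ⟨L₁, L₂, rfl, h₁, -⟩ := hP.split hord (hc P hP)
  have := hd _ h₁
  simp only [List.mem_append, List.mem_cons, List.not_mem_nil] at this ⊢
  tauto

/-- A bottleneck of `e → t` at or before `d` in the ordering is a bottleneck of `e → d`, provided
`d` reaches `t`: extend a path `e → d` to `t`. -/
theorem Separates.restrict {e t c d : E} (hc : N.Separates c e t) (hd : N.Reaches d t)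
    (hcd : c ≤ d) : N.Separates c e d := by
  intro P hP
  obtain ⟨Q, hQ⟩ := hd
  obtain ⟨R, hR, hmem⟩ := hP.trans hord hQ
  rcases (hmem c).mp (hc R hR) with h | h
  · exact h
  · obtain rfl := le_antisymm hcd (hQ.start_le hord h)
    exact hP.end_mem

theorem Separates.restrict_start {e t c d : E} (hc : N.Separates c e t) (hd : N.Reaches e d)
    (hcd : d ≤ c) : N.Separates c d t := by
  intro P hP
  obtain ⟨Q, hQ⟩ := hd
  obtain ⟨R, hR, hmem⟩ := hQ.trans hord hP
  rcases (hmem c).mp (hc R hR) with h | h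
  · obtain rfl := le_antisymm hcd (hQ.le_end hord h)
    exact hP.start_mem
  · exact h

end Topological

/-! ### The exponent of a path gain -/

/-- The exponent vector of the monomial `gain P`: it counts the consecutive pairs of `P`. -/
noncomputable def exponent (P : List E) : E × E →₀ ℕ :=
  ((P.zip P.tail).map fun i => Finsupp.single i 1).sum

theorem exponent_cons_cons (x y : E) (L : List E) :
    exponent (x :: y :: L) = Finsupp.single (x, y) 1 + exponent (y :: L) := by
  simp [exponent]

theorem gain_cons_cons (x y : E) (L : List E) :
    gain (x :: y :: L) = MvPolynomial.X (x, y) * gain (y :: L) := by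
  simp [gain]

theorem gain_eq_monomial (P : List E) : gain P = MvPolynomial.monomial (exponent P) 1 := by
  match P with
  | [] => simp [gain, exponent]
  | [x] => simp [gain, exponent]
  | x :: y :: L =>
    rw [gain_cons_cons, exponent_cons_cons, gain_eq_monomial (y :: L), MvPolynomial.X,
      MvPolynomial.monomial_mul, one_mul]

theorem gain_append_cons (L₁ L₂ : List E) (c : E) :
    gain (L₁ ++ c :: L₂) = gain (L₁ ++ [c]) * gain (c :: L₂) := by
  match L₁ with
  | [] => simp [gain]
  | [x] => simp [gain]
  | x :: y :: L =>
    have := gain_append_cons (y :: L) L₂ c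
    simp only [List.cons_append] at this ⊢
    rw [gain_cons_cons, gain_cons_cons, this, mul_assoc]

theorem exponent_ne_zero_iff {P : List E} {i : E × E} :
    exponent P i ≠ 0 ↔ i ∈ P.zip P.tail := by
  classical
  match P with
  | [] => simp [exponent]
  | [x] => simp [exponent]
  | x :: y :: L =>
    rw [exponent_cons_cons]
    have := exponent_ne_zero_iff (P := y :: L) (i := i)
    simp only [List.tail_cons] at this
    simp only [List.tail_cons, List.zip_cons_cons, List.mem_cons, ← this, Finsupp.add_apply,
      Finsupp.single_apply]
    split_ifs with h
    · simp [h]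
    · simp [Ne.symm h]

theorem mem_left_of_exponent_ne_zero {P : List E} {x y : E} (h : exponent P (x, y) ≠ 0) :
    x ∈ P := (List.of_mem_zip (exponent_ne_zero_iff.mp h)).1

theorem mem_right_of_exponent_ne_zero {P : List E} {x y : E} (h : exponent P (x, y) ≠ 0) :
    y ∈ P := List.mem_of_mem_tail (List.of_mem_zip (exponent_ne_zero_iff.mp h)).2

theorem exponent_le_one {P : List E} (hP : P.Nodup) (i : E × E) : exponent P i ≤ 1 := by
  classical
  match P with
  | [] => simp [exponent]
  | [x] => simp [exponent]
  | x :: y :: L =>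
    rw [exponent_cons_cons, Finsupp.add_apply, Finsupp.single_apply]
    split_ifs with h
    · have : exponent (y :: L) i = 0 := by
        by_contra h0
        subst h
        exact (List.nodup_cons.mp hP).1 (mem_left_of_exponent_ne_zero h0)
      simp [this]
    · simpa using exponent_le_one (List.nodup_cons.mp hP).2 i

/-- The edge following a given edge of a path is determined by the path. -/
theorem exponent_right_unique {P : List E} (hP : P.Nodup) {x y z : E}
    (hy : exponent P (x, y) ≠ 0) (hz : exponent P (x, z) ≠ 0) : y = z := by
  classical
  match P with
  | [] => simp [exponent] at hy
  | [w] => simp [exponent] at hy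
  | w :: v :: L =>
    have hn := List.nodup_cons.mp hP
    rw [exponent_cons_cons, Finsupp.add_apply, Finsupp.single_apply] at hy hz
    by_cases hx : w = x
    · subst hx
      have h0 (u) : exponent (v :: L) (w, u) = 0 := by
        by_contra h0
        exact hn.1 (mem_left_of_exponent_ne_zero h0)
      simp only [h0] at hy hz
      simp_all
    · simp only [Prod.mk.injEq, hx, false_and, if_false, zero_add] at hy hz
      exact exponent_right_unique hn.2 hy hz

/-- A path is determined by its first edge and the exponent of its gain. -/
theorem eq_of_exponent_eq {x : E} {P Q : List E} (hP : (x :: P).Nodup) (hQ : (x :: Q).Nodup)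
    (h : exponent (x :: P) = exponent (x :: Q)) : P = Q := by
  induction P generalizing x Q with
  | nil =>
    cases Q with
    | nil => rfl
    | cons z Q =>
      have := DFunLike.congr_fun h (x, z)
      rw [exponent_cons_cons] at this
      simp [exponent] at this
      omega
  | cons y P ih =>
    cases Q with
    | nil =>
      have := DFunLike.congr_fun h (x, y)
      rw [exponent_cons_cons] at this
      simp [exponent] at this
    | cons z Q =>
      obtain rfl : y = z := by
        refine exponent_right_unique hP (x := x) ?_ ?_
        · simp [exponent_cons_cons]
        · simp [h, exponent_cons_cons]
      rw [exponent_cons_cons, exponent_cons_cons, add_right_inj] at h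
      rw [ih (List.nodup_cons.mp hP).2 (List.nodup_cons.mp hQ).2 h]

theorem IsPath.exponent_inj {N : SISO V E} {e t t' : E} {P Q : List E} (hP : N.IsPath e t P)
    (hQ : N.IsPath e t' Q) (h : exponent P = exponent Q) : P = Q := by
  obtain ⟨L₁, rfl⟩ := hP.eq_cons
  obtain ⟨L₂, rfl⟩ := hQ.eq_cons
  rw [eq_of_exponent_eq hP.nodup hQ.nodup h]

theorem IsPath.exists_next {N : SISO V E} {e t x : E} {P : List E} (hP : N.IsPath e t P)
    (hx : x ∈ P) (hne : x ≠ t) : ∃ y, exponent P (x, y) ≠ 0 := by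
  obtain ⟨L₁, L₂, rfl⟩ := List.append_of_mem hx
  cases L₂ with
  | nil => have := hP.last; simp_all
  | cons y L₂ =>
    refine ⟨y, ?_⟩
    clear hx hP
    induction L₁ with
    | nil => simp [exponent_cons_cons]
    | cons a L₁ ih => cases L₁ <;> simp_all [exponent_cons_cons]

theorem IsPath.exists_prev {N : SISO V E} {e t y : E} {P : List E} (hP : N.IsPath e t P)
    (hy : y ∈ P) (hne : y ≠ e) : ∃ x, exponent P (x, y) ≠ 0 := by
  obtain ⟨L, rfl⟩ := hP.eq_cons
  replace hy : y ∈ L := by simpa [hne] using hy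
  clear hP hne
  induction L generalizing e with
  | nil => simp at hy
  | cons a L ih =>
    rcases List.mem_cons.mp hy with rfl | hy
    · exact ⟨e, by simp [exponent_cons_cons]⟩
    · obtain ⟨x, hx⟩ := ih (e := a) hy
      exact ⟨x, by simp_all [exponent_cons_cons]⟩

theorem pairwise_of_exponent_ne_zero {R : E → E → Prop} {P : List E} (hP : P.Pairwise R) {x y : E}
    (h : exponent P (x, y) ≠ 0) : R x y := by
  classical
  match P with
  | [] => simp [exponent] at h
  | [w] => simp [exponent] at h
  | w :: v :: L =>
    rw [exponent_cons_cons, Finsupp.add_apply, Finsupp.single_apply] at h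
    split_ifs at h with hw
    · obtain ⟨rfl, rfl⟩ := Prod.mk.inj hw
      exact List.rel_of_pairwise_cons hP (by simp)
    · exact pairwise_of_exponent_ne_zero hP.of_cons (by simpa using h)

theorem IsPath.lt_of_exponent_ne_zero [LinearOrder E] {N : SISO V E} (hord : N.IsTopological)
    {e t x y : E} {P : List E} (hP : N.IsPath e t P) (h : exponent P (x, y) ≠ 0) : x < y :=
  pairwise_of_exponent_ne_zero (pairwise_lt_of_isChain hord hP.chain) h

end SISO

/-! ### Transfer functions between arbitrary edges -/

namespace SISO

variable {V E : Type*}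

open MvPolynomial

section Transfer

variable [Fintype E] {N : SISO V E}

open Classical in
/-- The finite set of directed paths from `e` to `t`. -/
noncomputable def paths (N : SISO V E) (e t : E) : Finset (List E) :=
  (Finset.univ.filter fun P : {P : List E // P.Nodup} => N.IsPath e t P.1).map
    (Function.Embedding.subtype _)

@[simp]
theorem mem_paths {e t : E} {P : List E} : P ∈ N.paths e t ↔ N.IsPath e t P := by
  simpa [paths] using fun h : N.IsPath e t P => h.nodup

/-- The transfer function between two arbitrary edges: the sum of the gains of the directed paths
from `e` to `t`. -/
noncomputable def edgeTransfer (N : SISO V E) (e t : E) : MvPolynomial (E × E) (ZMod 2) :=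
  ∑ P ∈ N.paths e t, gain P

theorem transfer_eq_edgeTransfer (N : SISO V E) (i j : Fin 3) :
    N.transfer i j = N.edgeTransfer (N.σ i) (N.τ j) := by
  simp [transfer, edgeTransfer, paths]

theorem exists_isPath_of_mem_support {e t : E} {μ : E × E →₀ ℕ}
    (h : μ ∈ (N.edgeTransfer e t).support) : ∃ P, N.IsPath e t P ∧ exponent P = μ := by
  classical
  rw [mem_support_iff, edgeTransfer, coeff_sum] at h
  obtain ⟨P, hP, hne⟩ := Finset.exists_ne_zero_of_sum_ne_zero h
  rw [gain_eq_monomial, coeff_monomial] at hne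
  exact ⟨P, mem_paths.mp hP, by simpa using hne⟩

/-- Different paths from the same edge have different gains, so no gain cancels in a sum of
gains. -/
theorem IsPath.coeff_sum_gain [DecidableEq (List E)] {e t : E} {R : List E} (hR : N.IsPath e t R)
    {s : Finset (List E)} (hs : s ⊆ N.paths e t) :
    coeff (exponent R) (∑ P ∈ s, gain P) = if R ∈ s then 1 else 0 := by
  classical
  rw [coeff_sum, ← Finset.sum_ite_eq' s R fun _ => (1 : ZMod 2)]
  refine Finset.sum_congr rfl fun P hP => ?_
  rw [gain_eq_monomial, coeff_monomial]
  have := mem_paths.mp (hs hP)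
  exact if_congr ⟨fun h => this.exponent_inj hR h, fun h => h ▸ rfl⟩ rfl rfl

theorem IsPath.coeff_edgeTransfer {e t : E} {R : List E} (hR : N.IsPath e t R) :
    coeff (exponent R) (N.edgeTransfer e t) = 1 := by
  classical
  rw [edgeTransfer, hR.coeff_sum_gain subset_rfl, if_pos (mem_paths.mpr hR)]

theorem IsPath.exponent_mem_support {e t : E} {R : List E} (hR : N.IsPath e t R) :
    exponent R ∈ (N.edgeTransfer e t).support := by
  simp [hR.coeff_edgeTransfer]

theorem Reaches.edgeTransfer_ne_zero {e t : E} (h : N.Reaches e t) : N.edgeTransfer e t ≠ 0 := by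
  obtain ⟨R, hR⟩ := h
  intro h0
  simpa [h0] using hR.coeff_edgeTransfer

end Transfer

section Topological

variable [Fintype E] [LinearOrder E] {N : SISO V E} (hord : N.IsTopological)
include hord

open Classical in
/-- Concatenation at `c` is a bijection from pairs of paths `e → c`, `c → t` onto the paths
`e → t` through `c`. -/
theorem edgeTransfer_mul (e c t : E) :
    N.edgeTransfer e c * N.edgeTransfer c t = ∑ P ∈ N.paths e t with c ∈ P, gain P := by
  rw [edgeTransfer, edgeTransfer, Finset.sum_mul_sum, ← Finset.sum_product']
  refine Finset.sum_bij (fun p _ => p.1 ++ p.2.tail) ?_ ?_ ?_ ?_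
  · rintro ⟨P, Q⟩ hPQ
    simp only [Finset.mem_product, mem_paths] at hPQ
    obtain ⟨hP, hQ⟩ := hPQ
    obtain ⟨L₁, rfl⟩ := hP.eq_concat
    obtain ⟨L₂, rfl⟩ := hQ.eq_cons
    simpa using (isPath_append_cons_iff hord).mpr ⟨hP, hQ⟩
  · rintro ⟨P, Q⟩ hPQ ⟨P', Q'⟩ hPQ' h
    simp only [Finset.mem_product, mem_paths] at hPQ hPQ'
    obtain ⟨hP, hQ⟩ := hPQ
    obtain ⟨hP', hQ'⟩ := hPQ'
    obtain ⟨L₁, rfl⟩ := hP.eq_concat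
    obtain ⟨L₂, rfl⟩ := hQ.eq_cons
    obtain ⟨L₁', rfl⟩ := hP'.eq_concat
    obtain ⟨L₂', rfl⟩ := hQ'.eq_cons
    simp only [List.tail_cons, List.append_assoc, List.singleton_append] at h
    rw [List.append_cons_inj_of_notMem] at h
    · simp [h.1, h.2.2]
    · intro hc
      have := (List.pairwise_append.mp (pairwise_lt_of_isChain hord hP.chain)).2.2 c hc c (by simp)
      exact lt_irrefl _ this
    · exact (List.nodup_cons.mp hQ.nodup).1
  · intro P hP
    simp only [Finset.mem_filter, mem_paths] at hP
    obtain ⟨L₁, L₂, rfl, h₁, h₂⟩ := hP.1.split hord hP.2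
    exact ⟨(L₁ ++ [c], c :: L₂), by simp [h₁, h₂], by simp⟩
  · rintro ⟨P, Q⟩ hPQ
    simp only [Finset.mem_product, mem_paths] at hPQ
    obtain ⟨hP, hQ⟩ := hPQ
    obtain ⟨L₁, rfl⟩ := hP.eq_concat
    obtain ⟨L₂, rfl⟩ := hQ.eq_cons
    simp [gain_append_cons L₁ L₂ c]

theorem Separates.edgeTransfer_mul {e c t : E} (h : N.Separates c e t) :
    N.edgeTransfer e c * N.edgeTransfer c t = N.edgeTransfer e t := by
  classical
  rw [SISO.edgeTransfer_mul hord, edgeTransfer]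
  refine Finset.sum_congr (Finset.filter_true_of_mem fun P hP => h P (mem_paths.mp hP))
    fun _ _ => rfl

open Classical in
theorem IsPath.coeff_edgeTransfer_mul {e c t : E} {R : List E} (hR : N.IsPath e t R) :
    coeff (exponent R) (N.edgeTransfer e c * N.edgeTransfer c t) = if c ∈ R then 1 else 0 := by
  rw [SISO.edgeTransfer_mul hord, hR.coeff_sum_gain (Finset.filter_subset _ _)]
  simp [hR]

/-- If the paths from `e` to `t` decompose, over the field with two elements, into those through `a`
and those through `b`, then `a` and `b` are parallel and separate `e` from `t`: a path through both
would be counted `1` time on the left and `1 + 1 = 0` times on the right. -/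
theorem parallel_of_edgeTransfer_eq_add {e t a b : E} (hea : N.Reaches e a) (heb : N.Reaches e b)
    (hat : N.Reaches a t) (hbt : N.Reaches b t)
    (h : N.edgeTransfer e t = N.edgeTransfer e a * N.edgeTransfer a t +
      N.edgeTransfer e b * N.edgeTransfer b t) :
    ¬ N.Reaches a b ∧ ¬ N.Reaches b a ∧ ∀ P, N.IsPath e t P → a ∈ P ∨ b ∈ P := by
  classical
  have key (P) (hP : N.IsPath e t P) :
      (1 : ZMod 2) = (if a ∈ P then 1 else 0) + (if b ∈ P then 1 else 0) := by
    rw [← hP.coeff_edgeTransfer_mul hord, ← hP.coeff_edgeTransfer_mul hord, ← coeff_add, ← h,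
      hP.coeff_edgeTransfer]
  have hboth (P) (hP : N.IsPath e t P) (ha : a ∈ P) (hb : b ∈ P) : False := by
    have := key P hP
    rw [if_pos ha, if_pos hb] at this
    exact absurd this (by decide)
  refine ⟨?_, ?_, fun P hP => ?_⟩
  · rintro ⟨W, hW⟩
    obtain ⟨P, hP⟩ := hea
    obtain ⟨Q, hQ⟩ := hbt
    obtain ⟨R, hR, hRm⟩ := hP.trans hord hW
    obtain ⟨S, hS, hSm⟩ := hR.trans hord hQ
    exact hboth S hS ((hSm a).mpr (.inl ((hRm a).mpr (.inl hP.end_mem))))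
      ((hSm b).mpr (.inr hQ.start_mem))
  · rintro ⟨W, hW⟩
    obtain ⟨P, hP⟩ := heb
    obtain ⟨Q, hQ⟩ := hat
    obtain ⟨R, hR, hRm⟩ := hP.trans hord hW
    obtain ⟨S, hS, hSm⟩ := hR.trans hord hQ
    exact hboth S hS ((hSm a).mpr (.inr hQ.start_mem))
      ((hSm b).mpr (.inl ((hRm b).mpr (.inl hP.end_mem))))
  · by_contra hcon
    rw [not_or] at hcon
    have := key P hP
    rw [if_neg hcon.1, if_neg hcon.2] at this
    exact absurd this (by decide)

theorem edgeTransfer_eq_add {e t a b : E} (hab : ¬ N.Reaches a b) (hba : ¬ N.Reaches b a)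
    (h : ∀ P, N.IsPath e t P → a ∈ P ∨ b ∈ P) :
    N.edgeTransfer e t = N.edgeTransfer e a * N.edgeTransfer a t +
      N.edgeTransfer e b * N.edgeTransfer b t := by
  classical
  rw [edgeTransfer_mul hord, edgeTransfer_mul hord, ← Finset.sum_union, ← Finset.filter_or,
    Finset.filter_true_of_mem fun P hP => h P (mem_paths.mp hP), edgeTransfer]
  rw [Finset.disjoint_filter]
  intro P hP ha hb
  rw [mem_paths] at hP
  rcases le_total a b with hle | hle
  · exact hab (hP.reaches_of_le hord ha hb hle)
  · exact hba (hP.reaches_of_le hord hb ha hle)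

end Topological

end SISO

/-! ### Factors of multilinear polynomials -/

namespace MvPolynomial

variable {ι R : Type*} [CommRing R]

theorem disjoint_vars_of_mul [IsDomain R] {f h : MvPolynomial ι R} (h0 : f * h ≠ 0)
    (hlin : ∀ μ ∈ (f * h).support, ∀ i, μ i ≤ 1) : Disjoint f.vars h.vars := by
  rw [Finset.disjoint_left]
  intro i hf hh
  have hdeg : degreeOf i (f * h) ≤ 1 := degreeOf_le_iff.mpr fun μ hμ => hlin μ hμ i
  rw [degreeOf_mul_eq (left_ne_zero_of_mul h0) (right_ne_zero_of_mul h0)] at hdeg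
  obtain ⟨μ, hμ, hμi⟩ := (mem_vars_iff_mem_support _).mp hf
  obtain ⟨ν, hν, hνi⟩ := (mem_vars_iff_mem_support _).mp hh
  have h1 := monomial_le_degreeOf i hμ
  have h2 := monomial_le_degreeOf i hν
  have h3 := Nat.pos_of_ne_zero (Finsupp.mem_support_iff.mp hμi)
  have h4 := Nat.pos_of_ne_zero (Finsupp.mem_support_iff.mp hνi)
  omega

theorem eq_zero_of_mem_support_of_notMem_vars {f : MvPolynomial ι R} {μ : ι →₀ ℕ}
    (hμ : μ ∈ f.support) {i : ι} (hi : i ∉ f.vars) : μ i = 0 := by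
  by_contra hne
  exact hi ((mem_vars_iff_mem_support _).mpr ⟨μ, hμ, Finsupp.mem_support_iff.mpr hne⟩)

/-- For factors in disjoint sets of variables no two products of monomials coincide, so none
cancels. -/
theorem add_mem_support_mul [IsDomain R] {f h : MvPolynomial ι R} (hd : Disjoint f.vars h.vars)
    {μ ν : ι →₀ ℕ} (hμ : μ ∈ f.support) (hν : ν ∈ h.support) : μ + ν ∈ (f * h).support := by
  classical
  have hval : coeff (μ + ν) (f * h) = coeff μ f * coeff ν h := by
    rw [coeff_mul]
    refine Finset.sum_eq_single (μ, ν) ?_ (by simp)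
    rintro ⟨μ', ν'⟩ hsum hne
    by_contra hprod
    have hμ' : μ' ∈ f.support := mem_support_iff.mpr (left_ne_zero_of_mul hprod)
    have hν' : ν' ∈ h.support := mem_support_iff.mpr (right_ne_zero_of_mul hprod)
    rw [Finset.HasAntidiagonal.mem_antidiagonal] at hsum
    obtain rfl : μ' = μ := by
      ext i
      have hi := DFunLike.congr_fun hsum i
      simp only [Finsupp.add_apply] at hi
      by_cases hif : i ∈ f.vars
      · have hih := Finset.disjoint_left.mp hd hif
        rw [eq_zero_of_mem_support_of_notMem_vars hν' hih,
          eq_zero_of_mem_support_of_notMem_vars hν hih] at hi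
        simpa using hi
      · rw [eq_zero_of_mem_support_of_notMem_vars hμ' hif,
          eq_zero_of_mem_support_of_notMem_vars hμ hif]
    rw [add_right_inj] at hsum
    exact hne (Prod.ext rfl hsum)
  rw [mem_support_iff, hval]
  exact mul_ne_zero (mem_support_iff.mp hμ) (mem_support_iff.mp hν)

theorem exists_add_of_mem_support_mul {f h : MvPolynomial ι R} {κ : ι →₀ ℕ}
    (hκ : κ ∈ (f * h).support) : ∃ μ ∈ f.support, ∃ ν ∈ h.support, μ + ν = κ := by
  classical
  exact Finset.mem_add.mp (support_mul f h hκ)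

theorem exists_ne_zero_mem_support {K : Type*} [Field K] {f : MvPolynomial ι K} (hf : f ≠ 0)
    (hu : ¬ IsUnit f) : ∃ μ ∈ f.support, μ ≠ 0 := by
  classical
  by_contra! hcon
  have hC : f = C (coeff 0 f) := by
    ext μ
    rw [coeff_C]
    split_ifs with h
    · rw [h]
    · by_contra hne
      exact h (hcon μ (mem_support_iff.mpr hne)).symm
  refine hu ?_
  rw [hC]
  refine (IsUnit.mk0 _ fun h0 => hf ?_).map C
  rw [hC, h0, C_0]

end MvPolynomial

/-! ### Divisibility of transfer functions and bottlenecks -/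

namespace SISO

variable {V E : Type*}

open MvPolynomial

variable [Fintype E] {N : SISO V E}

theorem le_one_of_mem_support_edgeTransfer {e t : E} {μ : E × E →₀ ℕ}
    (h : μ ∈ (N.edgeTransfer e t).support) (i : E × E) : μ i ≤ 1 := by
  obtain ⟨P, hP, rfl⟩ := exists_isPath_of_mem_support h
  exact exponent_le_one hP.nodup i

theorem disjoint_vars_of_edgeTransfer_eq_mul {e t : E} {f h : MvPolynomial (E × E) (ZMod 2)}
    (hr : N.Reaches e t) (hfh : N.edgeTransfer e t = f * h) : Disjoint f.vars h.vars :=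
  disjoint_vars_of_mul (hfh ▸ hr.edgeTransfer_ne_zero)
    (hfh ▸ fun _ hμ => le_one_of_mem_support_edgeTransfer hμ)

/-- Every monomial of a multiple of `edgeTransfer x y` contains the gain of a path from `x`, hence a
variable leaving `x` when `x ≠ y`. -/
theorem separates_of_edgeTransfer_dvd {x y e t : E} (hne : x ≠ y)
    (h : N.edgeTransfer x y ∣ N.edgeTransfer e t) : N.Separates x e t := by
  intro P hP
  obtain ⟨g, hg⟩ := h
  obtain ⟨μ, hμ, ν, -, hsum⟩ := exists_add_of_mem_support_mul (hg ▸ hP.exponent_mem_support)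
  obtain ⟨R, hR, rfl⟩ := exists_isPath_of_mem_support hμ
  obtain ⟨z, hz⟩ := hR.exists_next hR.start_mem hne
  refine mem_left_of_exponent_ne_zero (y := z) ?_
  rw [← hsum, Finsupp.add_apply]
  omega

theorem separates_of_edgeTransfer_dvd_end {x e t : E}
    (h : N.edgeTransfer x t ∣ N.edgeTransfer e t) : N.Separates x e t := by
  rcases eq_or_ne x t with rfl | hne
  · exact N.separates_end e x
  · exact separates_of_edgeTransfer_dvd hne h

/-- If a path enters `c` by a variable of `f` and leaves it by a variable of the cofactor `h`, then
`c` lies on all paths `Q`: combining the `f`-part of this path with the `h`-part of `Q` gives a path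
again, which enters `c` and hence leaves it, and only a variable of `Q` can do that. -/
theorem separates_of_vars_change {e t x c y : E} {f h : MvPolynomial (E × E) (ZMod 2)}
    (hr : N.Reaches e t) (hct : c ≠ t) (hfh : N.edgeTransfer e t = f * h) {P : List E}
    (hP : N.IsPath e t P) (hx : exponent P (x, c) ≠ 0) (hy : exponent P (c, y) ≠ 0)
    (hxf : (x, c) ∈ f.vars) (hyf : (c, y) ∉ f.vars) : N.Separates c e t := by
  intro Q hQ
  have hd := disjoint_vars_of_edgeTransfer_eq_mul hr hfh
  obtain ⟨μ, hμ, ν, hν, hsum⟩ := exists_add_of_mem_support_mul (hfh ▸ hP.exponent_mem_support)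
  obtain ⟨μ', hμ', ν', hν', hsum'⟩ := exists_add_of_mem_support_mul (hfh ▸ hQ.exponent_mem_support)
  have hmix : μ + ν' ∈ (N.edgeTransfer e t).support := hfh ▸ add_mem_support_mul hd hμ hν'
  obtain ⟨R, hR, hRe⟩ := exists_isPath_of_mem_support hmix
  have hμx : μ (x, c) ≠ 0 := by
    have hν0 := eq_zero_of_mem_support_of_notMem_vars hν (Finset.disjoint_left.mp hd hxf)
    rw [← hsum, Finsupp.add_apply, hν0] at hx
    simpa using hx
  have hcR : c ∈ R := by
    refine mem_right_of_exponent_ne_zero (x := x) ?_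
    rw [hRe, Finsupp.add_apply]
    omega
  obtain ⟨z, hz⟩ := hR.exists_next hcR hct
  rw [hRe, Finsupp.add_apply] at hz
  by_cases hμz : μ (c, z) = 0
  · refine mem_left_of_exponent_ne_zero (y := z) ?_
    rw [← hsum', Finsupp.add_apply]
    omega
  · have hPz : exponent P (c, z) ≠ 0 := by
      rw [← hsum, Finsupp.add_apply]
      omega
    obtain rfl := exponent_right_unique hP.nodup hy hPz
    exact absurd (eq_zero_of_mem_support_of_notMem_vars hμ hyf) hμz

section Topological

variable [LinearOrder E] (hord : N.IsTopological)
include hord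

/-- The edge where the part of a path belonging to the factor `f` starts is a bottleneck. -/
theorem separates_of_minimal {e t c d : E} {f h : MvPolynomial (E × E) (ZMod 2)}
    (hr : N.Reaches e t) (hfh : N.edgeTransfer e t = f * h) {μ : E × E →₀ ℕ} (hμ : μ ∈ f.support)
    (hc : μ (c, d) ≠ 0) (hmin : ∀ x y, μ (x, y) ≠ 0 → c ≤ x) : N.Separates c e t := by
  have hd := disjoint_vars_of_edgeTransfer_eq_mul hr hfh
  obtain ⟨ν, hν⟩ : h.support.Nonempty :=
    support_nonempty.mpr (right_ne_zero_of_mul (hfh ▸ hr.edgeTransfer_ne_zero))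
  obtain ⟨P, hP, hPe⟩ := exists_isPath_of_mem_support (hfh ▸ add_mem_support_mul hd hμ hν)
  have hPc : exponent P (c, d) ≠ 0 := by
    rw [hPe, Finsupp.add_apply]
    omega
  rcases eq_or_ne c e with rfl | hne
  · exact N.separates_start c t
  obtain ⟨x, hx⟩ := hP.exists_prev (mem_left_of_exponent_ne_zero hPc) hne
  have hct : c ≠ t := ((hP.lt_of_exponent_ne_zero hord hPc).trans_le
    (hP.le_end hord (mem_right_of_exponent_ne_zero hPc))).ne
  have hdf : (c, d) ∈ f.vars :=
    (mem_vars_iff_mem_support _).mpr ⟨μ, hμ, Finsupp.mem_support_iff.mpr hc⟩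
  have hνx : ν (x, c) ≠ 0 := by
    -- Otherwise `(x, c)` would belong to the `f`-part and start before `c`.
    intro h0
    rw [hPe, Finsupp.add_apply, h0, add_zero] at hx
    have hxc := hP.lt_of_exponent_ne_zero hord (x := x) (y := c) (by
      rw [hPe, Finsupp.add_apply]
      omega)
    exact absurd (hmin x c hx) (not_le.mpr hxc)
  refine separates_of_vars_change hr hct (hfh.trans (mul_comm f h)) hP hx hPc ?_ ?_
  · exact (mem_vars_iff_mem_support _).mpr ⟨ν, hν, Finsupp.mem_support_iff.mpr hνx⟩
  · exact Finset.disjoint_left.mp hd hdf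

/-- The edge where the part of a path belonging to the factor `f` ends is a bottleneck. -/
theorem separates_of_maximal {e t c d : E} {f h : MvPolynomial (E × E) (ZMod 2)}
    (hr : N.Reaches e t) (hfh : N.edgeTransfer e t = f * h) {μ : E × E →₀ ℕ} (hμ : μ ∈ f.support)
    (hc : μ (c, d) ≠ 0) (hmax : ∀ x y, μ (x, y) ≠ 0 → y ≤ d) : N.Separates d e t := by
  have hd := disjoint_vars_of_edgeTransfer_eq_mul hr hfh
  obtain ⟨ν, hν⟩ : h.support.Nonempty :=
    support_nonempty.mpr (right_ne_zero_of_mul (hfh ▸ hr.edgeTransfer_ne_zero))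
  obtain ⟨P, hP, hPe⟩ := exists_isPath_of_mem_support (hfh ▸ add_mem_support_mul hd hμ hν)
  have hPc : exponent P (c, d) ≠ 0 := by
    rw [hPe, Finsupp.add_apply]
    omega
  rcases eq_or_ne d t with rfl | hne
  · exact N.separates_end e d
  obtain ⟨y, hy⟩ := hP.exists_next (mem_right_of_exponent_ne_zero hPc) hne
  have hdf : (c, d) ∈ f.vars :=
    (mem_vars_iff_mem_support _).mpr ⟨μ, hμ, Finsupp.mem_support_iff.mpr hc⟩
  have hνy : ν (d, y) ≠ 0 := by
    -- Otherwise `(d, y)` would belong to the `f`-part and end after `d`.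
    intro h0
    have hdy := hP.lt_of_exponent_ne_zero hord hy
    rw [hPe, Finsupp.add_apply, h0, add_zero] at hy
    exact absurd (hmax d y hy) (not_le.mpr hdy)
  refine separates_of_vars_change hr hne hfh hP hPc hy hdf ?_
  refine Finset.disjoint_right.mp hd ?_
  exact (mem_vars_iff_mem_support _).mpr ⟨ν, hν, Finsupp.mem_support_iff.mpr hνy⟩

/-- Transfer functions with at most one common bottleneck have no common factor: in a monomial of a
common factor, the first and the last edge are common bottlenecks. -/
theorem isRelPrime_edgeTransfer {e t e' t' : E} (hr : N.Reaches e t) (hr' : N.Reaches e' t')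
    (huniq : ∀ c d, N.Separates c e t → N.Separates c e' t' → N.Separates d e t →
      N.Separates d e' t' → ¬ c < d) :
    IsRelPrime (N.edgeTransfer e t) (N.edgeTransfer e' t') := by
  rintro f ⟨h, hfh⟩ ⟨h', hfh'⟩
  by_contra hu
  have hf0 : f ≠ 0 := left_ne_zero_of_mul (hfh ▸ hr.edgeTransfer_ne_zero)
  obtain ⟨μ, hμ, hμ0⟩ := exists_ne_zero_mem_support hf0 hu
  have hne : μ.support.Nonempty := Finsupp.support_nonempty_iff.mpr hμ0
  obtain ⟨⟨c, c'⟩, hc, hmin⟩ := μ.support.exists_min_image Prod.fst hne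
  obtain ⟨⟨d', d⟩, hd, hmax⟩ := μ.support.exists_max_image Prod.snd hne
  simp only [Finsupp.mem_support_iff] at hc hmin hd hmax
  have hmin' : ∀ x y, μ (x, y) ≠ 0 → c ≤ x := fun x y h => hmin (x, y) h
  have hmax' : ∀ x y, μ (x, y) ≠ 0 → y ≤ d := fun x y h => hmax (x, y) h
  obtain ⟨ν, hν⟩ : h.support.Nonempty :=
    support_nonempty.mpr (right_ne_zero_of_mul (hfh ▸ hr.edgeTransfer_ne_zero))
  obtain ⟨P, hP, hPe⟩ := exists_isPath_of_mem_support
    (hfh ▸ add_mem_support_mul (disjoint_vars_of_edgeTransfer_eq_mul hr hfh) hμ hν)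
  have hcc' : c < c' := hP.lt_of_exponent_ne_zero hord (by
    rw [hPe, Finsupp.add_apply]
    omega)
  exact huniq c d (separates_of_minimal hord hr hfh hμ hc hmin')
    (separates_of_minimal hord hr' hfh' hμ hc hmin')
    (separates_of_maximal hord hr hfh hμ hd hmax')
    (separates_of_maximal hord hr' hfh' hμ hd hmax') (hcc'.trans_le (hmax' c c' hc))

theorem isRelPrime_edgeTransfer_comp {e c t : E} (hec : N.Reaches e c) (hct : N.Reaches c t) :
    IsRelPrime (N.edgeTransfer e c) (N.edgeTransfer c t) :=
  isRelPrime_edgeTransfer hord hec hct fun _ _ _ hx hy _ hxy =>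
    absurd ((hy.le_end hord hec).trans (hx.start_le hord hct)) (not_le.mpr hxy)

end Topological

end SISO

/-! ### The transfer function identity and its graph-theoretic meaning -/

namespace SISO

variable {V E : Type*} [Fintype E] [LinearOrder E] {N : SISO V E} (hord : N.IsTopological)
include hord

theorem isRelPrime_of_last_bottleneck {a t t' : E} (hat : N.Reaches a t) (hat' : N.Reaches a t')
    (hlast : ∀ c, N.Separates c a t → N.Separates c a t' → c ≤ a) :
    IsRelPrime (N.edgeTransfer a t) (N.edgeTransfer a t') :=
  isRelPrime_edgeTransfer hord hat hat' fun _ d hc _ hd hd' hcd =>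
    absurd ((hlast d hd hd').trans (hc.start_le hord hat)) (not_le.mpr hcd)

theorem Separates.edgeTransfer_dvd {a d t : E} (had : N.Separates d a t) :
    N.edgeTransfer a d ∣ N.edgeTransfer a t ∧ N.edgeTransfer d t ∣ N.edgeTransfer a t :=
  ⟨⟨_, (had.edgeTransfer_mul hord).symm⟩, ⟨_, by rw [mul_comm, had.edgeTransfer_mul hord]⟩⟩

/-- If `d` is the last common bottleneck of `a → t₂` and `b → t₃`, the identity forces the transfer
function from `d` to `t₂` to divide the one from `s` to `t₂`, because it is coprime to all other
factors of its term. -/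
theorem edgeTransfer_dvd_of_last_common {s a b d t₁ t₂ t₃ : E}
    (hat₁ : N.Reaches a t₁) (hat₂ : N.Reaches a t₂) (hbt₃ : N.Reaches b t₃)
    (ha : ∀ c, N.Separates c a t₁ → N.Separates c a t₂ → c ≤ a)
    (h : N.edgeTransfer s t₁ * N.edgeTransfer a t₂ * N.edgeTransfer b t₃ =
      N.edgeTransfer s t₂ * N.edgeTransfer a t₁ * N.edgeTransfer b t₃ +
      N.edgeTransfer s t₃ * N.edgeTransfer b t₁ * N.edgeTransfer a t₂)
    (hda : N.Separates d a t₂) (hdb : N.Separates d b t₃)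
    (hd : ∀ c, N.Separates c a t₂ → N.Separates c b t₃ → c ≤ d) :
    N.edgeTransfer d t₂ ∣ N.edgeTransfer s t₂ := by
  have hdt₂ := hda.reaches_right hord hat₂
  have hdt₃ := hdb.reaches_right hord hbt₃
  have hrel₁ : IsRelPrime (N.edgeTransfer d t₂) (N.edgeTransfer a t₁) :=
    (isRelPrime_of_last_bottleneck hord hat₁ hat₂ ha).symm.of_dvd_left
      (Separates.edgeTransfer_dvd hord hda).2
  have hrel₂ : IsRelPrime (N.edgeTransfer d t₂) (N.edgeTransfer b d) :=
    (isRelPrime_edgeTransfer_comp hord (hdb.reaches_left hord hbt₃) hdt₂).symm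
  have hrel₃ : IsRelPrime (N.edgeTransfer d t₂) (N.edgeTransfer d t₃) :=
    isRelPrime_of_last_bottleneck hord hdt₂ hdt₃ fun c hc hc' =>
      hd c (hda.trans_right hord hc) (hdb.trans_right hord hc')
  have hdvd : N.edgeTransfer d t₂ ∣
      N.edgeTransfer s t₂ * (N.edgeTransfer a t₁ * N.edgeTransfer b t₃) := by
    have hU := (Separates.edgeTransfer_dvd hord hda).2
    have h' : N.edgeTransfer s t₂ * (N.edgeTransfer a t₁ * N.edgeTransfer b t₃) =
        (N.edgeTransfer s t₁ * N.edgeTransfer b t₃ -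
          N.edgeTransfer s t₃ * N.edgeTransfer b t₁) * N.edgeTransfer a t₂ := by
      linear_combination -h
    rw [h']
    exact hU.mul_left _
  rw [← hdb.edgeTransfer_mul hord] at hdvd
  exact (hrel₁.mul_right (hrel₂.mul_right hrel₃)).dvd_of_dvd_mul_right hdvd

/-- The identity for `s, a, b, d, t₁` fails when `a` lies on every path from `b` to `d`. For `a = b`
its right side vanishes in characteristic two; otherwise it says that the paths `s → t₁` are those
through `a` plus those through `b`, although `b` reaches `a`. -/
theorem false_of_separates {s a b d t₁ : E} (hst₁ : N.Reaches s t₁)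
    (had : N.Reaches a d) (hbd : N.Reaches b d) (hsd : N.Reaches s d) (hat₁ : N.Reaches a t₁)
    (hbt₁ : N.Reaches b t₁)
    (h : N.edgeTransfer s t₁ * N.edgeTransfer a d * N.edgeTransfer b d =
      N.edgeTransfer s d * (N.edgeTransfer a t₁ * N.edgeTransfer b d +
        N.edgeTransfer b t₁ * N.edgeTransfer a d))
    (habd : N.Separates a b d) (hbsd : a ≠ b → N.Separates b s d) : False := by
  rcases eq_or_ne a b with rfl | hne
  · rw [CharTwo.add_self_eq_zero, mul_zero] at h
    exact mul_ne_zero (mul_ne_zero hst₁.edgeTransfer_ne_zero had.edgeTransfer_ne_zero)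
      had.edgeTransfer_ne_zero h
  have hb := hbsd hne
  have hba := habd.reaches_left hord hbd
  have hsb := hb.reaches_left hord hsd
  have hbsa : N.Separates b s a := hb.restrict hord had (habd.start_le hord hbd)
  refine (parallel_of_edgeTransfer_eq_add hord (hsb.trans hord hba) hsb hat₁ hbt₁ ?_).2.1 hba
  rw [← hbsa.edgeTransfer_mul hord]
  refine mul_right_cancel₀ hbd.edgeTransfer_ne_zero
    (mul_right_cancel₀ had.edgeTransfer_ne_zero ?_)
  rw [← hb.edgeTransfer_mul hord] at h
  have h' := habd.edgeTransfer_mul hord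
  linear_combination h - N.edgeTransfer s b * N.edgeTransfer a t₁ * N.edgeTransfer b d * h'

/-- If `c` is the first common bottleneck of `a → d` and `b → d`, the transfer function from `a` to
`c` divides that from `s` to `d`, the only other factor of its term to which it need not be
coprime. -/
theorem edgeTransfer_dvd_of_first_common {s a b c d t₁ : E}
    (had : N.Reaches a d) (hbd : N.Reaches b d)
    (hrel : IsRelPrime (N.edgeTransfer a d) (N.edgeTransfer a t₁))
    (hca : N.Separates c a d) (hcb : N.Separates c b d)
    (hc : ∀ x, N.Separates x a c → N.Separates x b c → c ≤ x)
    (h : N.edgeTransfer s t₁ * N.edgeTransfer a d * N.edgeTransfer b d =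
      N.edgeTransfer s d * (N.edgeTransfer a t₁ * N.edgeTransfer b d +
        N.edgeTransfer b t₁ * N.edgeTransfer a d)) :
    N.edgeTransfer a c ∣ N.edgeTransfer s d := by
  have hac := hca.reaches_left hord had
  have hbc := hcb.reaches_left hord hbd
  have hcd := hca.reaches_right hord had
  have hrel₁ : IsRelPrime (N.edgeTransfer a c) (N.edgeTransfer a t₁) :=
    hrel.of_dvd_left (Separates.edgeTransfer_dvd hord hca).1
  have hrel₂ : IsRelPrime (N.edgeTransfer a c) (N.edgeTransfer b c) :=
    isRelPrime_edgeTransfer hord hac hbc fun x y hx hx' hy _ hxy =>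
      absurd ((hy.le_end hord hac).trans (hc x hx hx')) (not_le.mpr hxy)
  rw [← hca.edgeTransfer_mul hord, ← hcb.edgeTransfer_mul hord] at h
  refine (hrel₁.mul_right hrel₂).dvd_of_dvd_mul_right
    ⟨N.edgeTransfer s t₁ * N.edgeTransfer b c * N.edgeTransfer c d -
      N.edgeTransfer s d * N.edgeTransfer b t₁, ?_⟩
  refine mul_right_cancel₀ hcd.edgeTransfer_ne_zero ?_
  linear_combination -h

/-- The identity excludes a common bottleneck of `a → t₂` and `b → t₃`. Let `d` be the last one and
`c` the first one. Both `s → t₂` and `s → t₃` pass through `d`, which reduces the identity to one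
between transfer functions into `d`. There `a` and `b`, as far as they differ from `c`, are
bottlenecks of `s → d`. If both differed, the later one would lie on all paths from the earlier one
to `c`, and so be a common bottleneck before `c`. Hence one of them is `c`, and `false_of_separates`
applies. -/
theorem not_separates_common {s a b e t₁ t₂ t₃ : E}
    (hst₁ : N.Reaches s t₁) (hst₂ : N.Reaches s t₂)
    (hat₁ : N.Reaches a t₁) (hat₂ : N.Reaches a t₂) (hbt₁ : N.Reaches b t₁) (hbt₃ : N.Reaches b t₃)
    (ha : ∀ c, N.Separates c a t₁ → N.Separates c a t₂ → c ≤ a)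
    (hb : ∀ c, N.Separates c b t₁ → N.Separates c b t₃ → c ≤ b)
    (h : N.edgeTransfer s t₁ * N.edgeTransfer a t₂ * N.edgeTransfer b t₃ =
      N.edgeTransfer s t₂ * N.edgeTransfer a t₁ * N.edgeTransfer b t₃ +
      N.edgeTransfer s t₃ * N.edgeTransfer b t₁ * N.edgeTransfer a t₂)
    (hea : N.Separates e a t₂) (heb : N.Separates e b t₃) : False := by
  classical
  let S : Finset E := {x | N.Separates x a t₂ ∧ N.Separates x b t₃}
  have hS : S.Nonempty := ⟨e, by simp [S, hea, heb]⟩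
  obtain ⟨d, hdS, hdmax⟩ := S.exists_max_image id hS
  obtain ⟨c, hcS, hcmin⟩ := S.exists_min_image id hS
  have hcd : c ≤ d := hcmin d hdS
  simp only [S, Finset.mem_filter, Finset.mem_univ, true_and, id, and_imp] at hdS hdmax hcS hcmin
  obtain ⟨hda, hdb⟩ := hdS
  obtain ⟨hca, hcb⟩ := hcS
  have hds₂ : N.Separates d s t₂ := separates_of_edgeTransfer_dvd_end
    (edgeTransfer_dvd_of_last_common hord hat₁ hat₂ hbt₃ ha h hda hdb hdmax)
  have hds₃ : N.Separates d s t₃ := separates_of_edgeTransfer_dvd_end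
    (edgeTransfer_dvd_of_last_common hord hbt₁ hbt₃ hat₂ hb (by linear_combination h) hdb hda
      fun x hx hx' => hdmax x hx' hx)
  have hsd := hds₂.reaches_left hord hst₂
  have had := hda.reaches_left hord hat₂
  have hbd := hdb.reaches_left hord hbt₃
  have hdt₂ := hda.reaches_right hord hat₂
  have hdt₃ := hdb.reaches_right hord hbt₃
  have hred : N.edgeTransfer s t₁ * N.edgeTransfer a d * N.edgeTransfer b d =
      N.edgeTransfer s d * (N.edgeTransfer a t₁ * N.edgeTransfer b d +
        N.edgeTransfer b t₁ * N.edgeTransfer a d) := by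
    rw [← hda.edgeTransfer_mul hord, ← hdb.edgeTransfer_mul hord, ← hds₂.edgeTransfer_mul hord,
      ← hds₃.edgeTransfer_mul hord] at h
    refine mul_right_cancel₀ hdt₂.edgeTransfer_ne_zero
      (mul_right_cancel₀ hdt₃.edgeTransfer_ne_zero ?_)
    linear_combination h
  have hred' : N.edgeTransfer s t₁ * N.edgeTransfer b d * N.edgeTransfer a d =
      N.edgeTransfer s d * (N.edgeTransfer b t₁ * N.edgeTransfer a d +
        N.edgeTransfer a t₁ * N.edgeTransfer b d) := by
    linear_combination hred
  have hcad : N.Separates c a d := hca.restrict hord hdt₂ hcd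
  have hcbd : N.Separates c b d := hcb.restrict hord hdt₃ hcd
  have hcmin' (x) (hx : N.Separates x a c) (hx' : N.Separates x b c) : c ≤ x :=
    hcmin x (hca.trans_left hord hx) (hcb.trans_left hord hx')
  have hasd : a ≠ c → N.Separates a s d := fun hne => separates_of_edgeTransfer_dvd hne
    (edgeTransfer_dvd_of_first_common hord had hbd
      ((isRelPrime_of_last_bottleneck hord hat₁ hat₂ ha).symm.of_dvd_left
        (Separates.edgeTransfer_dvd hord hda).1) hcad hcbd hcmin' hred)
  have hbsd : b ≠ c → N.Separates b s d := fun hne => separates_of_edgeTransfer_dvd hne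
    (edgeTransfer_dvd_of_first_common hord hbd had
      ((isRelPrime_of_last_bottleneck hord hbt₁ hbt₃ hb).symm.of_dvd_left
        (Separates.edgeTransfer_dvd hord hdb).1) hcbd hcad (fun x hx hx' => hcmin' x hx' hx) hred')
  by_cases hac : a = c
  · subst hac
    exact false_of_separates hord hst₁ had hbd hsd hat₁ hbt₁ hred hcbd fun hne => hbsd hne.symm
  by_cases hbc : b = c
  · subst hbc
    exact false_of_separates hord hst₁ hbd had hsd hbt₁ hat₁ hred' hcad fun hne => hasd hne.symm
  have hac' : a ≤ c := hca.start_le hord hat₂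
  have hbc' : b ≤ c := hcb.start_le hord hbt₃
  have hcdr := hcad.reaches_right hord had
  rcases le_total a b with hab | hba
  · have hsa := (hasd hac).reaches_left hord hsd
    have hbac : N.Separates b a c :=
      ((hbsd hbc).restrict hord hcdr hbc').restrict_start hord hsa hab
    exact hbc (le_antisymm hbc' (hcmin' b hbac (N.separates_start b c)))
  · have hsb := (hbsd hbc).reaches_left hord hsd
    have habc : N.Separates a b c :=
      ((hasd hac).restrict hord hcdr hac').restrict_start hord hsb hba
    exact hac (le_antisymm hac' (hcmin' a (N.separates_start a c) habc))

/-- The graph-theoretic meaning of the polynomial identity, for arbitrary edges `sᵢ`, `tⱼ`. Here `a`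
is the last bottleneck between `s₃` and `{t₁, t₂}`, and `b` the last one between `s₂` and
`{t₁, t₃}`. -/
theorem edgeTransfer_identity_iff {s₁ s₂ s₃ t₁ t₂ t₃ a b : E}
    (h₁₁ : N.Reaches s₁ t₁) (h₁₂ : N.Reaches s₁ t₂) (h₁₃ : N.Reaches s₁ t₃)
    (h₂₁ : N.Reaches s₂ t₁) (h₂₃ : N.Reaches s₂ t₃) (h₃₁ : N.Reaches s₃ t₁) (h₃₂ : N.Reaches s₃ t₂)
    (ha₁ : N.Separates a s₃ t₁) (ha₂ : N.Separates a s₃ t₂)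
    (ha : ∀ c, N.Separates c s₃ t₁ → N.Separates c s₃ t₂ → c ≤ a)
    (hb₁ : N.Separates b s₂ t₁) (hb₃ : N.Separates b s₂ t₃)
    (hb : ∀ c, N.Separates c s₂ t₁ → N.Separates c s₂ t₃ → c ≤ b) :
    N.edgeTransfer s₁ t₁ * N.edgeTransfer s₂ t₃ * N.edgeTransfer s₃ t₂ =
      N.edgeTransfer s₁ t₂ * N.edgeTransfer s₂ t₃ * N.edgeTransfer s₃ t₁ +
      N.edgeTransfer s₁ t₃ * N.edgeTransfer s₂ t₁ * N.edgeTransfer s₃ t₂ ↔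
    N.Separates a s₁ t₂ ∧ N.Separates b s₁ t₃ ∧ (¬ N.Reaches a b ∧ ¬ N.Reaches b a) ∧
      ∀ P, N.IsPath s₁ t₁ P → a ∈ P ∨ b ∈ P := by
  have hsa := ha₁.reaches_left hord h₃₁
  have hsb := hb₁.reaches_left hord h₂₁
  have hat₁ := ha₁.reaches_right hord h₃₁
  have hat₂ := ha₂.reaches_right hord h₃₂
  have hbt₁ := hb₁.reaches_right hord h₂₁
  have hbt₃ := hb₃.reaches_right hord h₂₃
  rw [← ha₁.edgeTransfer_mul hord, ← ha₂.edgeTransfer_mul hord, ← hb₁.edgeTransfer_mul hord,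
    ← hb₃.edgeTransfer_mul hord]
  constructor
  · intro h
    have hred : N.edgeTransfer s₁ t₁ * N.edgeTransfer a t₂ * N.edgeTransfer b t₃ =
        N.edgeTransfer s₁ t₂ * N.edgeTransfer a t₁ * N.edgeTransfer b t₃ +
        N.edgeTransfer s₁ t₃ * N.edgeTransfer b t₁ * N.edgeTransfer a t₂ := by
      refine mul_right_cancel₀ hsa.edgeTransfer_ne_zero
        (mul_right_cancel₀ hsb.edgeTransfer_ne_zero ?_)
      linear_combination h
    have ha' (c) (hc₁ : N.Separates c a t₁) (hc₂ : N.Separates c a t₂) : c ≤ a :=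
      ha c (ha₁.trans_right hord hc₁) (ha₂.trans_right hord hc₂)
    have hb' (c) (hc₁ : N.Separates c b t₁) (hc₃ : N.Separates c b t₃) : c ≤ b :=
      hb c (hb₁.trans_right hord hc₁) (hb₃.trans_right hord hc₃)
    have hrel : IsRelPrime (N.edgeTransfer a t₂) (N.edgeTransfer b t₃) :=
      isRelPrime_edgeTransfer hord hat₂ hbt₃ fun c _ hc hc' _ _ _ =>
        not_separates_common hord h₁₁ h₁₂ hat₁ hat₂ hbt₁ hbt₃ ha' hb' hred hc hc'
    have ha₁₂ : N.Separates a s₁ t₂ := by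
      refine separates_of_edgeTransfer_dvd_end
        (((isRelPrime_of_last_bottleneck hord hat₁ hat₂ ha').symm.mul_right
          hrel).dvd_of_dvd_mul_right ⟨N.edgeTransfer s₁ t₁ * N.edgeTransfer b t₃ -
            N.edgeTransfer s₁ t₃ * N.edgeTransfer b t₁, ?_⟩)
      linear_combination -hred
    have hb₁₃ : N.Separates b s₁ t₃ := by
      refine separates_of_edgeTransfer_dvd_end
        (((isRelPrime_of_last_bottleneck hord hbt₁ hbt₃ hb').symm.mul_right
          hrel.symm).dvd_of_dvd_mul_right ⟨N.edgeTransfer s₁ t₁ * N.edgeTransfer a t₂ -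
            N.edgeTransfer s₁ t₂ * N.edgeTransfer a t₁, ?_⟩)
      linear_combination -hred
    have hsum : N.edgeTransfer s₁ t₁ = N.edgeTransfer s₁ a * N.edgeTransfer a t₁ +
        N.edgeTransfer s₁ b * N.edgeTransfer b t₁ := by
      rw [← ha₁₂.edgeTransfer_mul hord, ← hb₁₃.edgeTransfer_mul hord] at hred
      refine mul_right_cancel₀ hat₂.edgeTransfer_ne_zero
        (mul_right_cancel₀ hbt₃.edgeTransfer_ne_zero ?_)
      linear_combination hred
    obtain ⟨hab, hba, hcut⟩ := parallel_of_edgeTransfer_eq_add hord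
      (ha₁₂.reaches_left hord h₁₂) (hb₁₃.reaches_left hord h₁₃) hat₁ hbt₁ hsum
    exact ⟨ha₁₂, hb₁₃, ⟨hab, hba⟩, hcut⟩
  · rintro ⟨ha₁₂, hb₁₃, ⟨hab, hba⟩, hcut⟩
    rw [← ha₁₂.edgeTransfer_mul hord, ← hb₁₃.edgeTransfer_mul hord,
      edgeTransfer_eq_add hord hab hba hcut]
    ring

end SISO

/-! ### Reduction of the three equations to the identity -/

namespace SISO

variable {V E : Type*} [Fintype E]

theorem m_ne_zero {N : SISO V E} (hconn : N.FullyConnected) (i j : Fin 3) : N.m i j ≠ 0 := by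
  rw [m, transfer_eq_edgeTransfer, Ne, FaithfulSMul.algebraMap_eq_zero_iff]
  exact Reaches.edgeTransfer_ne_zero (hconn i j)

variable [LinearOrder E]

theorem α_spec (N : SISO V E) (i j k : Fin 3) :
    N.Separates (N.α i j k) (N.σ i) (N.τ j) ∧ N.Separates (N.α i j k) (N.σ i) (N.τ k) := by
  have : N.α i j k ∈ N.bottlenecks {N.σ i} {N.τ j, N.τ k} := Finset.max'_mem _ _
  simpa [bottlenecks, isBottleneck_pair_iff] using this

theorem le_α {N : SISO V E} {i j k : Fin 3} {c : E} (hj : N.Separates c (N.σ i) (N.τ j))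
    (hk : N.Separates c (N.σ i) (N.τ k)) : c ≤ N.α i j k :=
  Finset.le_max' _ _ (by simp [bottlenecks, isBottleneck_pair_iff, hj, hk])

theorem m_identity_iff {N : SISO V E} (hord : N.IsTopological) (hconn : N.FullyConnected)
    (i j k : Fin 3) :
    N.m i i * N.m j k * N.m k j = N.m i j * N.m j k * N.m k i + N.m i k * N.m j i * N.m k j ↔
      N.IsBottleneck (N.α k i j) {N.σ i} {N.τ j} ∧
      N.IsBottleneck (N.α j i k) {N.σ i} {N.τ k} ∧
      N.Parallel (N.α k i j) (N.α j i k) ∧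
      N.IsCutSet {N.α k i j, N.α j i k} {N.σ i} {N.τ i} := by
  have hcut : N.IsCutSet {N.α k i j, N.α j i k} {N.σ i} {N.τ i} ↔
      ∀ P, N.IsPath (N.σ i) (N.τ i) P → N.α k i j ∈ P ∨ N.α j i k ∈ P := by
    simp [IsCutSet]
  rw [isBottleneck_singleton_iff, isBottleneck_singleton_iff, hcut]
  refine Iff.trans ?_ (edgeTransfer_identity_iff hord (hconn i i) (hconn i j) (hconn i k)
    (hconn j i) (hconn j k) (hconn k i) (hconn k j) (N.α_spec k i j).1 (N.α_spec k i j).2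
    (fun _ => le_α) (N.α_spec j i k).1 (N.α_spec j i k).2 (fun _ => le_α))
  simp only [m, transfer_eq_edgeTransfer, ← map_mul, ← map_add]
  exact (FaithfulSMul.algebraMap_injective _ _).eq_iff

end SISO

theorem mainTheorem3 {V E : Type*} [Fintype E] [LinearOrder E] (N : SISO V E)
    (hord : N.IsTopological) (hconn : N.FullyConnected) :
    ((1 + N.η ≠ 0 ∧ N.p₁ = N.η / (1 + N.η)) ↔
      N.IsBottleneck (N.α 3 1 2) {N.σ 1} {N.τ 2} ∧
      N.IsBottleneck (N.α 2 1 3) {N.σ 1} {N.τ 3} ∧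
      N.Parallel (N.α 3 1 2) (N.α 2 1 3) ∧
      N.IsCutSet {N.α 3 1 2, N.α 2 1 3} {N.σ 1} {N.τ 1}) ∧
    (N.p₂ = 1 + N.η ↔
      N.IsBottleneck (N.α 1 2 3) {N.σ 2} {N.τ 3} ∧
      N.IsBottleneck (N.α 3 2 1) {N.σ 2} {N.τ 1} ∧
      N.Parallel (N.α 1 2 3) (N.α 3 2 1) ∧
      N.IsCutSet {N.α 1 2 3, N.α 3 2 1} {N.σ 2} {N.τ 2}) ∧
    (N.p₃ = 1 + N.η ↔
      N.IsBottleneck (N.α 2 3 1) {N.σ 3} {N.τ 1} ∧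
      N.IsBottleneck (N.α 1 3 2) {N.σ 3} {N.τ 2} ∧
      N.Parallel (N.α 2 3 1) (N.α 1 3 2) ∧
      N.IsCutSet {N.α 2 3 1, N.α 1 3 2} {N.σ 3} {N.τ 3}) := by
  have hm := SISO.m_ne_zero hconn
  rw [← SISO.m_identity_iff hord hconn 1 2 3, ← SISO.m_identity_iff hord hconn 2 3 1,
    ← SISO.m_identity_iff hord hconn 3 1 2]
  have hη : 1 + N.η = (N.m 1 2 * N.m 2 3 * N.m 3 1 + N.m 1 3 * N.m 2 1 * N.m 3 2) /
      (N.m 1 2 * N.m 2 3 * N.m 3 1) := by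
    rw [SISO.η]
    have h12 := hm 1 2
    have h23 := hm 2 3
    have h31 := hm 3 1
    field_simp
  refine ⟨⟨?_, fun h => ?_⟩, ?_, ?_⟩
  · rintro ⟨hne, h⟩
    have hS : N.m 1 2 * N.m 2 3 * N.m 3 1 + N.m 1 3 * N.m 2 1 * N.m 3 2 ≠ 0 := by
      rintro h0
      rw [hη, h0, zero_div] at hne
      exact hne rfl
    rw [SISO.p₁, hη, SISO.η, div_div_div_cancel_right₀ (by simp [hm]),
      div_eq_div_iff (by simp [hm]) hS] at h
    refine mul_right_cancel₀ (mul_ne_zero (hm 1 3) (hm 2 1)) ?_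
    linear_combination -h
  · have hS : N.m 1 2 * N.m 2 3 * N.m 3 1 + N.m 1 3 * N.m 2 1 * N.m 3 2 ≠ 0 := by
      rw [← h]
      simp [hm]
    rw [hη]
    refine ⟨div_ne_zero hS (by simp [hm]), ?_⟩
    rw [SISO.p₁, SISO.η, div_div_div_cancel_right₀ (by simp [hm]), div_eq_div_iff (by simp [hm]) hS]
    linear_combination -(N.m 1 3 * N.m 2 1) * h
  · rw [SISO.p₂, hη, div_eq_div_iff (by simp [hm]) (by simp [hm])]
    constructor <;> intro h
    · refine mul_right_cancel₀ (mul_ne_zero (hm 1 2) (hm 2 3)) ?_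
      linear_combination h
    · linear_combination (N.m 1 2 * N.m 2 3) * h
  · rw [SISO.p₃, hη, div_eq_div_iff (by simp [hm]) (by simp [hm])]
    constructor <;> intro h
    · refine mul_right_cancel₀ (mul_ne_zero (hm 2 3) (hm 3 1)) ?_
      linear_combination h
    · linear_combination (N.m 2 3 * N.m 3 1) * h
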